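/- Let $m\ge 1$ be an integer and let $\theta_1,\theta_2>1$, $\kappa_A,\kappa_B>0$, $\kappa_C\ge 1$, $\sigma_0>0$, $L\ge 3$. For every twice continuously differentiable $f:\mathbb{R}^n\to\mathbb{R}$ (any $n$) that is bounded below by some $f_{\rm low}$ and satisfies $\|\nabla^2 f(y)-\nabla^2 f(z)\|\le L\|y-z\|$ for all $y,z\in\mathbb{R}^n$ (vectors carry the Euclidean norm and matrices the induced operator norm), consider any sequences of iterates $x_k\in\mathbb{R}^n$, steps $s_k\in\mathbb{R}^n$, matrices $B_k\in\mathbb{R}^{n\times n}$ and parameters $\sigma_k$ ($k\ge 0$) generated by Algorithm ARp-approx with $p=2$. This means that $x_0\in\mathbb{R}^n$ is arbitrary, $\sigma_0$ is the given number, and, with the convention $\|s_j\|=1$ for $j<0$ and with $$\overline{T}_k(s)=f(x_k)+\nabla f(x_k)^\top s+\tfrac12 s^\top B_k s,\qquad m_k(s)=\overline{T}_k(s)+\tfrac{\sigma_k}{6}\|s\|^3,\qquad \widetilde B_{k}=\int_0^1\nabla^2 f(x_{k}+ts_{k})\,dt,$$ the following hold for every $k\ge 0$: - if $k \bmod m=0$,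 then $\|B_k-\nabla^2 f(x_k)\|\le\min\bigl(\kappa_A\sum_{i=1}^m\|s_{k-i}\|,\ \kappa_B\bigr)$; - if $k\bmod m\ne 0$, then $\|B_k-\widetilde B_{k-1}\|\le\kappa_C\|B_{k-1}-\widetilde B_{k-1}\|$; - $m_k(s_k)-m_k(0)\le 0$, $\ \|\nabla\overline{T}_k(s_k)\|\le\frac{\theta_1\sigma_k\|s_k\|^2}{2}$, and $\ \max[0,-\lambda_{\min}(\nabla^2\overline{T}_k(s_k))]\le\theta_2\sigma_k\|s_k\|$; - $x_{k+1}=x_k+s_k$ and $\sigma_{k+1}=\sigma_k+\sigma_k\|s_k\|^3$. Then, for every $k\ge 0$, $$\min_{1\le j\le k+1}\|\nabla f(x_j)\|\le\frac{C_1}{(k+1)^{2/3}},\qquad \min_{1\le j\le k+1}\max[0,-\lambda_{\min}(\nabla^2 f(x_j))]\le\frac{C_2}{(k+1)^{1/3}},$$ where the constants $C_1,C_2$ depend only on $m,\theta_1,\theta_2,\kappa_A,\kappa_B,\kappa_C,\sigma_0,L$ and on upper bounds for $f(x_0)-f_{\rm low}$, $\|\nabla f(x_0)\|$ and $\max[0,-\lambda_{\min}(\nabla^2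 f(x_0))]$; in particular they depend neither on $k$ or $n$ nor on the choice of the matrices $B_k$ and the steps $s_k$. No bound on $B_k$ or on its curvature is assumed. (Here $\lambda_{\min}$ is the leftmost eigenvalue of a symmetric matrix, and $\max[0,-\lambda_{\min}]=0$ if $n=0$.) -/

import Mathlib

noncomputable section

namespace ARApprox

/-- The Hessian of `f` at `x`, as the linear operator `d ↦ ∇²f(x) d`. -/
def hessian {n : ℕ} (f : EuclideanSpace ℝ (Fin n) → ℝ) (x : EuclideanSpace ℝ (Fin n)) :
    EuclideanSpace ℝ (Fin n) →L[ℝ] EuclideanSpace ℝ (Fin n) :=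
  fderiv ℝ (gradient f) x

/-- The leftmost (real) eigenvalue of an operator. In dimension zero there is no eigenvalue and
the value is `0`. -/
def lambdaMin {n : ℕ} (A : EuclideanSpace ℝ (Fin n) →L[ℝ] EuclideanSpace ℝ (Fin n)) : ℝ :=
  sInf {μ : ℝ | Module.End.HasEigenvalue
    (A : EuclideanSpace ℝ (Fin n) →ₗ[ℝ] EuclideanSpace ℝ (Fin n)) μ}

/-- `max[0, -λ_min(∇²f(x))]`. -/
def negCurvature {n : ℕ} (f : EuclideanSpace ℝ (Fin n) → ℝ) (x : EuclideanSpace ℝ (Fin n)) : ℝ :=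
  max 0 (-lambdaMin (hessian f x))

/-- The second-order Taylor expansion of `f` at `x`, as a function of the step, with the matrix `B`
in place of the Hessian. -/
def approxTaylor {n : ℕ} (f : EuclideanSpace ℝ (Fin n) → ℝ) (x : EuclideanSpace ℝ (Fin n))
    (B : EuclideanSpace ℝ (Fin n) →L[ℝ] EuclideanSpace ℝ (Fin n))
    (s : EuclideanSpace ℝ (Fin n)) : ℝ :=
  f x + inner ℝ (gradient f x) s + (1 / 2) * inner ℝ s (B s)

/-- The cubically regularized model. -/
def model {n : ℕ} (f : EuclideanSpace ℝ (Fin n) → ℝ) (x : EuclideanSpace ℝ (Fin n))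
    (B : EuclideanSpace ℝ (Fin n) →L[ℝ] EuclideanSpace ℝ (Fin n)) (σ : ℝ)
    (s : EuclideanSpace ℝ (Fin n)) : ℝ :=
  approxTaylor f x B s + σ / 6 * ‖s‖ ^ 3

/-- The Hessian of `f` averaged over the segment from `x` to `x + s`. -/
def averagedHessian {n : ℕ} (f : EuclideanSpace ℝ (Fin n) → ℝ) (x s : EuclideanSpace ℝ (Fin n)) :
    EuclideanSpace ℝ (Fin n) →L[ℝ] EuclideanSpace ℝ (Fin n) :=
  ∫ t in (0 : ℝ)..1, hessian f (x + t • s)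

/-- The step lengths `‖s_j‖`, with the convention `‖s_j‖ = 1` for `j < 0`. -/
def stepLength {n : ℕ} (s : ℕ → EuclideanSpace ℝ (Fin n)) (j : ℤ) : ℝ :=
  if j < 0 then 1 else ‖s j.toNat‖

/-- The sequences `x`, `s`, `B`, `σ` of iterates, steps, Hessian approximations and regularization
parameters are generated on `f` by the second-order (`p = 2`) instance of the adaptive
regularization algorithm with approximate tensor, with memory length `m` and the
parameters `θ₁, θ₂, κA, κB, κC, σ₀`. -/
structure IsRun {n : ℕ} (m : ℕ) (θ₁ θ₂ κA κB κC σ₀ : ℝ)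
    (f : EuclideanSpace ℝ (Fin n) → ℝ)
    (x s : ℕ → EuclideanSpace ℝ (Fin n))
    (B : ℕ → EuclideanSpace ℝ (Fin n) →L[ℝ] EuclideanSpace ℝ (Fin n))
    (σ : ℕ → ℝ) : Prop where
  sigma_zero : σ 0 = σ₀
  /-- Accuracy of the approximation when it is recomputed. -/
  refresh : ∀ k : ℕ, k % m = 0 →
    ‖B k - hessian f (x k)‖ ≤
      min (κA * ∑ i ∈ Finset.Icc 1 m, stepLength s ((k : ℤ) - (i : ℤ))) κB
  /-- Accuracy of the approximation at the other iterations. -/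
  update : ∀ k : ℕ, (k + 1) % m ≠ 0 →
    ‖B (k + 1) - averagedHessian f (x k) (s k)‖ ≤
      κC * ‖B k - averagedHessian f (x k) (s k)‖
  model_decrease : ∀ k : ℕ,
    model f (x k) (B k) (σ k) (s k) - model f (x k) (B k) (σ k) 0 ≤ 0
  step_gradient : ∀ k : ℕ,
    ‖gradient (approxTaylor f (x k) (B k)) (s k)‖ ≤ θ₁ * σ k * ‖s k‖ ^ 2 / 2
  step_curvature : ∀ k : ℕ,
    negCurvature (approxTaylor f (x k) (B k)) (s k) ≤ θ₂ * σ k * ‖s k‖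
  iterate_succ : ∀ k : ℕ, x (k + 1) = x k + s k
  sigma_succ : ∀ k : ℕ, σ (k + 1) = σ k + σ k * ‖s k‖ ^ 3

end ARApprox

end

/-!
Write `ω` for the step lengths. The update rule and the Lipschitz condition bound the Hessian error
`e` by a multiple of the sum of the last `2 * m` step lengths, so `∑ e ω²` is at most a constant
plus a multiple of `∑ ω³`: the same order as the cubic Taylor remainders. Summing the model decrease
then gives `σ_K ≤ const + 6 c ∑ ω³`, for a constant `c` and with the sum over the first `K` steps.
Conversely `12 c ∑ ω³ ≤ σ_K + const`: once `σ ≥ 12 c`, every step raises `σ` by at least `12 c ω³`,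
and before that the gradient and the negative curvature at the current iterate are controlled by the
earlier, bounded steps, so that the cubic model decrease bounds the next step. Together the two
estimates bound `σ`, hence also `∑ ω³ ≤ σ / σ₀`. The gradient and the negative curvature at the next
iterate are at most multiples of the square and of the first power of a sum of recent step lengths,
and the pigeonhole principle yields one index at which both rates hold.
-/

open scoped NNReal

namespace ARApprox

section Window

/-- The value of `ω` at the index `k - i`, where negative indices give `1` as in `stepLength`. -/
def lag (ω : ℕ → ℝ) (i k : ℕ) : ℝ := if k < i then 1 else ω (k - i)

/-- The sum of the values of `ω` at the `N` indices that precede `k`, with `k` excluded. -/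
def window (ω : ℕ → ℝ) (N k : ℕ) : ℝ := ∑ i ∈ Finset.range N, lag ω (i + 1) k

variable {ω : ℕ → ℝ}

theorem lag_zero_left (ω : ℕ → ℝ) (k : ℕ) : lag ω 0 k = ω k := by simp [lag]

theorem lag_succ_succ (ω : ℕ → ℝ) (i k : ℕ) : lag ω (i + 1) (k + 1) = lag ω i k := by simp [lag]

theorem lag_succ_zero (ω : ℕ → ℝ) (i : ℕ) : lag ω (i + 1) 0 = 1 := by simp [lag]

theorem lag_nonneg (hω : ∀ k, 0 ≤ ω k) (i k : ℕ) : 0 ≤ lag ω i k := by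
  unfold lag
  split_ifs <;> simp [hω]

theorem window_nonneg (hω : ∀ k, 0 ≤ ω k) (N k : ℕ) : 0 ≤ window ω N k :=
  Finset.sum_nonneg fun _ _ => lag_nonneg hω _ _

theorem window_mono (hω : ∀ k, 0 ≤ ω k) {M N : ℕ} (hMN : M ≤ N) (k : ℕ) :
    window ω M k ≤ window ω N k :=
  Finset.sum_le_sum_of_subset_of_nonneg (Finset.range_mono hMN) fun _ _ _ => lag_nonneg hω _ _

theorem window_succ_succ (ω : ℕ → ℝ) (N k : ℕ) :
    window ω (N + 1) (k + 1) = window ω N k + ω k := by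
  simp [window, Finset.sum_range_succ', lag_succ_succ, lag_zero_left]

theorem window_le_mul {Y : ℝ} (hY : 1 ≤ Y) (N : ℕ) {k : ℕ} (h : ∀ j < k, ω j ≤ Y) :
    window ω N k ≤ N * Y := by
  have hlag : ∀ i ∈ Finset.range N, lag ω (i + 1) k ≤ Y := fun i _ => by
    unfold lag
    split_ifs with hk
    · exact hY
    · exact h _ (by omega)
  simpa [window] using Finset.sum_le_card_nsmul _ _ _ hlag

theorem sum_lag_cube_le (hω : ∀ k, 0 ≤ ω k) (i K : ℕ) :
    ∑ k ∈ Finset.range K, lag ω i k ^ 3 ≤ ∑ k ∈ Finset.range K, ω k ^ 3 + i := by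
  induction i generalizing K with
  | zero => simp [lag_zero_left]
  | succ i ih =>
    cases K with
    | zero =>
      rw [Finset.sum_range_zero, Finset.sum_range_zero, zero_add]
      exact Nat.cast_nonneg _
    | succ K =>
      rw [Finset.sum_range_succ', Finset.sum_range_succ _ K]
      simp only [lag_succ_succ, lag_succ_zero]
      push_cast
      linarith [ih K, pow_nonneg (hω K) 3]

theorem sum_window_succ_cube_le (hω : ∀ k, 0 ≤ ω k) (N K : ℕ) :
    ∑ k ∈ Finset.range K, window ω (N + 1) (k + 1) ^ 3 ≤
      (N + 1 : ℝ) ^ 3 * (∑ k ∈ Finset.range K, ω k ^ 3 + N) := by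
  simp only [window, lag_succ_succ]
  calc ∑ k ∈ Finset.range K, (∑ i ∈ Finset.range (N + 1), lag ω i k) ^ 3
      ≤ ∑ k ∈ Finset.range K, (N + 1 : ℝ) ^ 2 * ∑ i ∈ Finset.range (N + 1), lag ω i k ^ 3 := by
        refine Finset.sum_le_sum fun k _ => ?_
        simpa using pow_sum_le_card_mul_sum_pow (s := Finset.range (N + 1))
          (fun i _ => lag_nonneg hω i k) 2
    _ = (N + 1 : ℝ) ^ 2 * ∑ i ∈ Finset.range (N + 1), ∑ k ∈ Finset.range K, lag ω i k ^ 3 := by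
        rw [← Finset.mul_sum, Finset.sum_comm]
    _ ≤ (N + 1 : ℝ) ^ 2 *
          ∑ _i ∈ Finset.range (N + 1), (∑ k ∈ Finset.range K, ω k ^ 3 + N) := by
        gcongr with i hi
        refine (sum_lag_cube_le hω i K).trans ?_
        gcongr
        exact Nat.lt_succ_iff.1 (Finset.mem_range.1 hi)
    _ = (N + 1 : ℝ) ^ 3 * (∑ k ∈ Finset.range K, ω k ^ 3 + N) := by
        rw [Finset.sum_const, Finset.card_range, nsmul_eq_mul]
        push_cast
        ring

theorem sum_stepLength_eq_window {n : ℕ} (s : ℕ → EuclideanSpace ℝ (Fin n)) (m k : ℕ) :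
    ∑ i ∈ Finset.Icc 1 m, stepLength s ((k : ℤ) - (i : ℤ)) = window (fun j => ‖s j‖) m k := by
  rw [window, Finset.range_eq_Ico, Finset.sum_Ico_add' (fun i => lag (fun j => ‖s j‖) i k) 0 m 1]
  refine Finset.sum_congr rfl fun i _ => ?_
  unfold stepLength lag
  by_cases h : k < i
  · rw [if_pos (by omega), if_pos h]
  · rw [if_neg (by omega), if_neg h]
    congr 2
    omega

end Window

section ErrorPropagation

variable {m : ℕ} {a b κ : ℝ} {ω e : ℕ → ℝ}

theorem error_le_window_of_refresh_at (ha : 0 ≤ a) (hb : 0 ≤ b) (hκ : 1 ≤ κ)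
    (hω : ∀ k, 0 ≤ ω k) (hrefresh : ∀ k, k % m = 0 → e k ≤ a * window ω m k)
    (hupdate : ∀ k, (k + 1) % m ≠ 0 → e (k + 1) ≤ κ * (e k + b * ω k)) (q : ℕ) {r : ℕ}
    (hr : r < m) :
    e (m * q + r) ≤ κ ^ r * (a + b) * window ω (m + r) (m * q + r) := by
  induction r with
  | zero =>
    refine (hrefresh (m * q + 0) (by simp)).trans ?_
    have := window_nonneg hω m (m * q)
    rw [pow_zero, one_mul, add_zero, add_zero]
    gcongr
    linarith
  | succ r ih =>
    have hmod : (m * q + r + 1) % m ≠ 0 := by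
      rw [add_assoc, Nat.mul_add_mod, Nat.mod_eq_of_lt hr]
      exact r.succ_ne_zero
    have hb_le : b ≤ κ ^ r * (a + b) :=
      (le_add_of_nonneg_left ha).trans
        (le_mul_of_one_le_left (add_nonneg ha hb) (one_le_pow₀ hκ))
    have hω_r := hω (m * q + r)
    rw [← add_assoc, ← add_assoc, window_succ_succ]
    calc e (m * q + r + 1) ≤ κ * (e (m * q + r) + b * ω (m * q + r)) := hupdate _ hmod
      _ ≤ κ * (κ ^ r * (a + b) * window ω (m + r) (m * q + r)
            + κ ^ r * (a + b) * ω (m * q + r)) := by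
          gcongr
          exact ih (Nat.lt_of_succ_lt hr)
      _ = κ ^ (r + 1) * (a + b) * (window ω (m + r) (m * q + r) + ω (m * q + r)) := by ring

theorem error_le_window (hm : 1 ≤ m) (ha : 0 ≤ a) (hb : 0 ≤ b) (hκ : 1 ≤ κ)
    (hω : ∀ k, 0 ≤ ω k) (hrefresh : ∀ k, k % m = 0 → e k ≤ a * window ω m k)
    (hupdate : ∀ k, (k + 1) % m ≠ 0 → e (k + 1) ≤ κ * (e k + b * ω k)) (k : ℕ) :
    e k ≤ κ ^ m * (a + b) * window ω (2 * m) k := by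
  have hr : k % m < m := Nat.mod_lt k hm
  have hlocal := error_le_window_of_refresh_at ha hb hκ hω hrefresh hupdate (k / m) hr
  rw [Nat.div_add_mod] at hlocal
  have := window_nonneg hω (m + k % m) k
  refine hlocal.trans ?_
  gcongr
  exact window_mono hω (by omega) k

end ErrorPropagation

section Elementary

theorem le_one_add_of_pow_le {w c : ℝ} {n : ℕ} (hn : n ≠ 0) (hc : 0 ≤ c) (h : w ^ n ≤ c) :
    w ≤ 1 + c := by
  rcases le_total w 1 with hw | hw
  · linarith
  · linarith [le_self_pow₀ hw hn]

theorem le_one_add_div_of_cubic_le {a b c w : ℝ} (ha : 0 < a) (hb : 0 ≤ b) (hc : 0 ≤ c)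
    (h : a * w ^ 3 ≤ b * w + c * w ^ 2) : w ≤ 1 + (b + c) / a := by
  rcases le_or_gt w 1 with hw | hw
  · exact hw.trans (le_add_of_nonneg_right (by positivity))
  have hlead : a * w * w ^ 2 ≤ (b + c) * w ^ 2 := by
    have : b * w ≤ b * w ^ 2 := by gcongr; exact le_self_pow₀ hw.le two_ne_zero
    linarith
  have hle : w ≤ (b + c) / a := by
    rw [le_div_iff₀' ha]
    exact le_of_mul_le_mul_right hlead (by positivity)
  linarith

theorem exists_le_rpow_inv_of_sum_pow_le {ι : Type*} {t : Finset ι} (ht : t.Nonempty)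
    {u : ι → ℝ} (hu : ∀ i ∈ t, 0 ≤ u i) {p : ℕ} (hp : p ≠ 0) {D : ℝ}
    (h : ∑ i ∈ t, u i ^ p ≤ D) : ∃ i ∈ t, u i ≤ (D / t.card) ^ (p : ℝ)⁻¹ := by
  have hcard : (t.card : ℝ) ≠ 0 := Nat.cast_ne_zero.2 ht.card_ne_zero
  obtain ⟨i, hi, hle⟩ : ∃ i ∈ t, u i ^ p ≤ D / t.card :=
    Finset.exists_le_of_sum_le ht (by simpa [mul_div_cancel₀ _ hcard] using h)
  have hroot : 0 ≤ u i ^ p := pow_nonneg (hu i hi) p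
  refine ⟨i, hi, ?_⟩
  rwa [Real.le_rpow_inv_iff_of_pos (hu i hi) (hroot.trans hle) (by positivity), Real.rpow_natCast]

end Elementary

/-- The data on which the complexity constants depend: `N` and `κ` govern the Hessian error
(at most `κ` times the sum of the `N` preceding step lengths), `Δ` bounds the achievable decrease
of the objective, and `G`, `β` bound the initial gradient norm and negative curvature. -/
structure RateParams where
  (N : ℕ)
  (κ L θ₁ θ₂ σ₀ Δ G β : ℝ)
  κ_nonneg : 0 ≤ κ
  L_nonneg : 0 ≤ L
  θ₁_nonneg : 0 ≤ θ₁
  θ₂_nonneg : 0 ≤ θ₂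
  σ₀_pos : 0 < σ₀

namespace RateParams

variable (p : RateParams)

/-- Bound on the Hessian error as long as the regularization parameter is at most `M`; here
`1 + M / σ₀` bounds the lengths of the earlier steps. -/
noncomputable def errorBound (M : ℝ) : ℝ := p.κ * (p.N * (1 + M / p.σ₀))

/-- Bound on the gradient norm as long as the regularization parameter is at most `M`. -/
noncomputable def gradientBound (M : ℝ) : ℝ :=
  max p.G ((p.L + p.θ₁ * M / 2) * (1 + M / p.σ₀) ^ 2 + p.errorBound M * (1 + M / p.σ₀))

/-- Bound on the negative curvature as long as the regularization parameter is at most `M`. -/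
noncomputable def curvatureBound (M : ℝ) : ℝ :=
  max p.β (p.errorBound M + (p.L + p.θ₂ * M) * (1 + M / p.σ₀))

/-- Bound on the step length as long as the regularization parameter is at most `M`. -/
noncomputable def stepBound (M : ℝ) : ℝ :=
  1 + (p.gradientBound M + (p.curvatureBound M + p.errorBound M)) / (p.σ₀ / 6)

/-- The coefficient of `∑ ω³` in the bound on the total increase that the Taylor remainders and the
Hessian errors can cause. -/
noncomputable def cubeCoeff : ℝ := p.L + p.κ * (p.N + 1) ^ 3

/-- Uniform bound on the regularization parameter. The threshold `12 * cubeCoeff` is twice the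
value at which the regularization compensates the errors. -/
noncomputable def sigmaBound : ℝ :=
  2 * (p.σ₀ + 6 * (p.Δ + p.κ * (p.N + 1) ^ 3 * p.N) +
    6 * p.cubeCoeff * (12 * p.cubeCoeff / p.σ₀ + p.stepBound (12 * p.cubeCoeff) ^ 3))

/-- Uniform bound on the sum of the cubes of the sums of `N + 1` consecutive step lengths. -/
noncomputable def windowCubeBound : ℝ := (p.N + 1) ^ 3 * (p.sigmaBound / p.σ₀ + p.N)

/-- The constant in the rate of decrease of the gradient norm. -/
noncomputable def gradientConst : ℝ :=
  (p.L + p.θ₁ * p.sigmaBound / 2 + p.κ) * p.windowCubeBound ^ (2 / 3 : ℝ)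

/-- The constant in the rate of decrease of the negative curvature. -/
noncomputable def curvatureConst : ℝ :=
  (p.κ + (p.L + p.θ₂ * p.sigmaBound)) * p.windowCubeBound ^ (1 / 3 : ℝ)

variable {p} {M : ℝ}

theorem one_le_one_add_div (p : RateParams) (hM : 0 ≤ M) : 1 ≤ 1 + M / p.σ₀ :=
  le_add_of_nonneg_right (div_nonneg hM p.σ₀_pos.le)

theorem errorBound_nonneg (hM : 0 ≤ M) : 0 ≤ p.errorBound M :=
  mul_nonneg p.κ_nonneg
    (mul_nonneg p.N.cast_nonneg (zero_le_one.trans (p.one_le_one_add_div hM)))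

theorem gradientBound_nonneg (hM : 0 ≤ M) : 0 ≤ p.gradientBound M := by
  have := p.σ₀_pos
  have := p.L_nonneg
  have := p.θ₁_nonneg
  have := p.errorBound_nonneg hM
  exact le_max_of_le_right (by positivity)

theorem curvatureBound_nonneg (hM : 0 ≤ M) : 0 ≤ p.curvatureBound M := by
  have := p.σ₀_pos
  have := p.L_nonneg
  have := p.θ₂_nonneg
  have := p.errorBound_nonneg hM
  exact le_max_of_le_right (by positivity)

theorem stepBound_nonneg (hM : 0 ≤ M) : 0 ≤ p.stepBound M := by
  have := p.σ₀_pos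
  have := p.errorBound_nonneg hM
  have := p.gradientBound_nonneg hM
  have := p.curvatureBound_nonneg hM
  unfold stepBound
  positivity

theorem cubeCoeff_nonneg (p : RateParams) : 0 ≤ p.cubeCoeff := by
  have := p.L_nonneg
  have := p.κ_nonneg
  unfold cubeCoeff
  positivity

end RateParams

/-- The scalar relations between consecutive iterations on which the complexity analysis rests:
`ω` are the step lengths, `σ` the regularization parameters, `F` the objective values, `g` the
gradient norms, `χ` the negative curvatures and `e` the Hessian errors. -/
structure ScalarRun (p : RateParams) (ω σ F g χ e : ℕ → ℝ) : Prop where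
  step_nonneg : ∀ k, 0 ≤ ω k
  sigma_zero : σ 0 = p.σ₀
  sigma_succ : ∀ k, σ (k + 1) = σ k + σ k * ω k ^ 3
  decrease_le : ∀ k, F 0 - F k ≤ p.Δ
  gradient_zero_le : g 0 ≤ p.G
  curvature_zero_le : χ 0 ≤ p.β
  objective_succ_le : ∀ k, F (k + 1) ≤ F k - σ k / 6 * ω k ^ 3 + p.L * ω k ^ 3 + e k * ω k ^ 2
  cubic_le : ∀ k, σ k / 6 * ω k ^ 3 ≤ g k * ω k + (χ k + e k) * ω k ^ 2
  gradient_succ_le : ∀ k, g (k + 1) ≤ (p.L + p.θ₁ * σ k / 2) * ω k ^ 2 + e k * ω k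
  curvature_succ_le : ∀ k, χ (k + 1) ≤ e k + (p.L + p.θ₂ * σ k) * ω k
  error_le : ∀ k, e k ≤ p.κ * window ω p.N k

namespace ScalarRun

variable {p : RateParams} {ω σ F g χ e : ℕ → ℝ} {M : ℝ} {k : ℕ}

theorem sigma_zero_le (h : ScalarRun p ω σ F g χ e) (k : ℕ) : p.σ₀ ≤ σ k := by
  induction k with
  | zero => exact h.sigma_zero.ge
  | succ k ih =>
    rw [h.sigma_succ]
    exact le_add_of_le_of_nonneg ih
      (mul_nonneg (p.σ₀_pos.le.trans ih) (pow_nonneg (h.step_nonneg k) 3))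

theorem sigma_nonneg (h : ScalarRun p ω σ F g χ e) (k : ℕ) : 0 ≤ σ k :=
  p.σ₀_pos.le.trans (h.sigma_zero_le k)

theorem monotone_sigma (h : ScalarRun p ω σ F g χ e) : Monotone σ :=
  monotone_nat_of_le_succ fun k => by
    rw [h.sigma_succ]
    exact le_add_of_nonneg_right (mul_nonneg (h.sigma_nonneg k) (pow_nonneg (h.step_nonneg k) 3))

theorem sum_cube_le_sigma_div (h : ScalarRun p ω σ F g χ e) (K : ℕ) :
    ∑ k ∈ Finset.range K, ω k ^ 3 ≤ σ K / p.σ₀ := by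
  rw [le_div_iff₀' p.σ₀_pos]
  induction K with
  | zero => simpa using h.sigma_nonneg 0
  | succ K ih =>
    rw [Finset.sum_range_succ, h.sigma_succ, mul_add]
    exact add_le_add ih
      (mul_le_mul_of_nonneg_right (h.sigma_zero_le K) (pow_nonneg (h.step_nonneg K) 3))

theorem step_le_of_sigma_le (h : ScalarRun p ω σ F g χ e) (hk : σ k ≤ M) {j : ℕ} (hj : j < k) :
    ω j ≤ 1 + M / p.σ₀ := by
  have hM : 0 ≤ M := (h.sigma_nonneg k).trans hk
  have hσ₀ := p.σ₀_pos
  refine le_one_add_of_pow_le three_ne_zero (by positivity) ?_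
  calc ω j ^ 3 ≤ ∑ i ∈ Finset.range k, ω i ^ 3 :=
        Finset.single_le_sum (f := fun i => ω i ^ 3)
          (fun i _ => pow_nonneg (h.step_nonneg i) 3) (Finset.mem_range.2 hj)
    _ ≤ σ k / p.σ₀ := h.sum_cube_le_sigma_div k
    _ ≤ M / p.σ₀ := by gcongr

theorem error_le_of_sigma_le (h : ScalarRun p ω σ F g χ e) (hk : σ k ≤ M) :
    e k ≤ p.errorBound M :=
  (h.error_le k).trans <| mul_le_mul_of_nonneg_left
    (window_le_mul (p.one_le_one_add_div ((h.sigma_nonneg k).trans hk)) p.N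
      fun _ => h.step_le_of_sigma_le hk) p.κ_nonneg

theorem gradient_le_of_sigma_le (h : ScalarRun p ω σ F g χ e) (hk : σ k ≤ M) :
    g k ≤ p.gradientBound M := by
  cases k with
  | zero => exact le_max_of_le_left h.gradient_zero_le
  | succ k =>
    have hσ : σ k ≤ M := (h.monotone_sigma k.le_succ).trans hk
    have hω := h.step_le_of_sigma_le hk k.lt_succ_self
    have hω₀ := h.step_nonneg k
    have hL := p.L_nonneg
    have hθ₁ := p.θ₁_nonneg
    have hM : 0 ≤ M := (h.sigma_nonneg k).trans hσ
    have hE : 0 ≤ p.errorBound M := RateParams.errorBound_nonneg hM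
    refine (h.gradient_succ_le k).trans (le_max_of_le_right ?_)
    gcongr
    exact h.error_le_of_sigma_le hσ

theorem curvature_le_of_sigma_le (h : ScalarRun p ω σ F g χ e) (hk : σ k ≤ M) :
    χ k ≤ p.curvatureBound M := by
  cases k with
  | zero => exact le_max_of_le_left h.curvature_zero_le
  | succ k =>
    have hσ : σ k ≤ M := (h.monotone_sigma k.le_succ).trans hk
    have hω := h.step_le_of_sigma_le hk k.lt_succ_self
    have hω₀ := h.step_nonneg k
    have hL := p.L_nonneg
    have hθ₂ := p.θ₂_nonneg
    have hM : 0 ≤ M := (h.sigma_nonneg k).trans hσ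
    refine (h.curvature_succ_le k).trans (le_max_of_le_right ?_)
    gcongr
    exact h.error_le_of_sigma_le hσ

theorem step_le_stepBound (h : ScalarRun p ω σ F g χ e) (hk : σ k ≤ M) : ω k ≤ p.stepBound M := by
  have hM : 0 ≤ M := (h.sigma_nonneg k).trans hk
  have hω := h.step_nonneg k
  have hcubic : p.σ₀ / 6 * ω k ^ 3 ≤
      p.gradientBound M * ω k + (p.curvatureBound M + p.errorBound M) * ω k ^ 2 :=
    calc p.σ₀ / 6 * ω k ^ 3 ≤ σ k / 6 * ω k ^ 3 := by gcongr; exact h.sigma_zero_le k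
      _ ≤ g k * ω k + (χ k + e k) * ω k ^ 2 := h.cubic_le k
      _ ≤ p.gradientBound M * ω k + (p.curvatureBound M + p.errorBound M) * ω k ^ 2 := by
        gcongr
        exacts [h.gradient_le_of_sigma_le hk, h.curvature_le_of_sigma_le hk,
          h.error_le_of_sigma_le hk]
  exact le_one_add_div_of_cubic_le (div_pos p.σ₀_pos (by norm_num))
    (RateParams.gradientBound_nonneg hM)
    (add_nonneg (RateParams.curvatureBound_nonneg hM) (RateParams.errorBound_nonneg hM)) hcubic

theorem step_le_window (h : ScalarRun p ω σ F g χ e) (k : ℕ) :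
    ω k ≤ window ω (p.N + 1) (k + 1) := by
  rw [window_succ_succ]
  exact le_add_of_nonneg_left (window_nonneg h.step_nonneg _ _)

theorem error_le_window_succ (h : ScalarRun p ω σ F g χ e) (k : ℕ) :
    e k ≤ p.κ * window ω (p.N + 1) (k + 1) := by
  refine (h.error_le k).trans (mul_le_mul_of_nonneg_left ?_ p.κ_nonneg)
  rw [window_succ_succ]
  exact le_add_of_nonneg_right (h.step_nonneg k)

theorem sum_error_mul_sq_le (h : ScalarRun p ω σ F g χ e) (K : ℕ) :
    ∑ k ∈ Finset.range K, e k * ω k ^ 2 ≤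
      p.κ * ((p.N + 1) ^ 3 * (∑ k ∈ Finset.range K, ω k ^ 3 + p.N)) := by
  have hκ := p.κ_nonneg
  calc ∑ k ∈ Finset.range K, e k * ω k ^ 2
      ≤ ∑ k ∈ Finset.range K, p.κ * window ω (p.N + 1) (k + 1) ^ 3 := by
        refine Finset.sum_le_sum fun k _ => ?_
        have hW := window_nonneg h.step_nonneg (p.N + 1) (k + 1)
        have hω := h.step_nonneg k
        calc e k * ω k ^ 2
            ≤ p.κ * window ω (p.N + 1) (k + 1) * window ω (p.N + 1) (k + 1) ^ 2 := by
              gcongr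
              exacts [h.error_le_window_succ k, h.step_le_window k]
          _ = p.κ * window ω (p.N + 1) (k + 1) ^ 3 := by ring
    _ ≤ p.κ * ((p.N + 1) ^ 3 * (∑ k ∈ Finset.range K, ω k ^ 3 + p.N)) := by
        rw [← Finset.mul_sum]
        gcongr
        exact sum_window_succ_cube_le h.step_nonneg p.N K

theorem sigma_le_add_mul_sum_cube (h : ScalarRun p ω σ F g χ e) (K : ℕ) :
    σ K ≤ p.σ₀ + 6 * (p.Δ + p.κ * (p.N + 1) ^ 3 * p.N) +
      6 * p.cubeCoeff * ∑ k ∈ Finset.range K, ω k ^ 3 := by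
  have hsum : ∑ k ∈ Finset.range K, (σ (k + 1) - σ k) ≤
      ∑ k ∈ Finset.range K, 6 * ((F k - F (k + 1)) + (p.L * ω k ^ 3 + e k * ω k ^ 2)) :=
    Finset.sum_le_sum fun k _ => by linarith [h.sigma_succ k, h.objective_succ_le k]
  rw [Finset.sum_range_sub, h.sigma_zero, ← Finset.mul_sum, Finset.sum_add_distrib,
    Finset.sum_range_sub', Finset.sum_add_distrib, ← Finset.mul_sum] at hsum
  unfold RateParams.cubeCoeff
  linarith [h.decrease_le K, h.sum_error_mul_sq_le K]

theorem mul_sum_cube_sub_le_sigma (h : ScalarRun p ω σ F g χ e) (hM : 0 ≤ M) (K : ℕ) :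
    M * (∑ k ∈ Finset.range K, ω k ^ 3 - (M / p.σ₀ + p.stepBound M ^ 3)) ≤ σ K := by
  have hσ₀ := p.σ₀_pos
  induction K with
  | zero =>
    have hY := RateParams.stepBound_nonneg (p := p) hM
    have hthreshold : 0 ≤ M / p.σ₀ + p.stepBound M ^ 3 := by positivity
    rw [Finset.sum_range_zero, zero_sub]
    exact (mul_nonpos_of_nonneg_of_nonpos hM (neg_nonpos.2 hthreshold)).trans (h.sigma_nonneg 0)
  | succ K ih =>
    have hω := h.step_nonneg K
    rw [Finset.sum_range_succ]
    rcases le_total M (σ K) with habove | hbelow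
    · have hraise : M * ω K ^ 3 ≤ σ K * ω K ^ 3 := by gcongr
      linarith [h.sigma_succ K]
    · have hearlier : ∑ k ∈ Finset.range K, ω k ^ 3 ≤ M / p.σ₀ :=
        (h.sum_cube_le_sigma_div K).trans (by gcongr)
      have hlast : ω K ^ 3 ≤ p.stepBound M ^ 3 := by gcongr; exact h.step_le_stepBound hbelow
      exact (mul_nonpos_of_nonneg_of_nonpos hM (by linarith)).trans (h.sigma_nonneg (K + 1))

theorem sigma_le_sigmaBound (h : ScalarRun p ω σ F g χ e) (K : ℕ) : σ K ≤ p.sigmaBound := by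
  have hM : 0 ≤ 12 * p.cubeCoeff := mul_nonneg (by norm_num) p.cubeCoeff_nonneg
  have hlower := h.mul_sum_cube_sub_le_sigma hM K
  have hupper := h.sigma_le_add_mul_sum_cube K
  unfold RateParams.sigmaBound
  linarith

theorem sum_window_cube_le_windowCubeBound (h : ScalarRun p ω σ F g χ e) (K : ℕ) :
    ∑ k ∈ Finset.range K, window ω (p.N + 1) (k + 1) ^ 3 ≤ p.windowCubeBound := by
  have hσ₀ := p.σ₀_pos
  refine (sum_window_succ_cube_le h.step_nonneg p.N K).trans ?_
  unfold RateParams.windowCubeBound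
  gcongr
  exact (h.sum_cube_le_sigma_div K).trans (by gcongr; exact h.sigma_le_sigmaBound K)

theorem gradient_succ_le_window_sq (h : ScalarRun p ω σ F g χ e) (k : ℕ) :
    g (k + 1) ≤
      (p.L + p.θ₁ * p.sigmaBound / 2 + p.κ) * window ω (p.N + 1) (k + 1) ^ 2 := by
  have hW := window_nonneg h.step_nonneg (p.N + 1) (k + 1)
  have hκ := p.κ_nonneg
  have hL := p.L_nonneg
  have hθ₁ := p.θ₁_nonneg
  have hω := h.step_nonneg k
  have hS : 0 ≤ p.sigmaBound := (h.sigma_nonneg k).trans (h.sigma_le_sigmaBound k)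
  calc g (k + 1) ≤ (p.L + p.θ₁ * σ k / 2) * ω k ^ 2 + e k * ω k := h.gradient_succ_le k
    _ ≤ (p.L + p.θ₁ * p.sigmaBound / 2) * window ω (p.N + 1) (k + 1) ^ 2 +
          p.κ * window ω (p.N + 1) (k + 1) * window ω (p.N + 1) (k + 1) := by
        gcongr
        exacts [h.sigma_le_sigmaBound k, h.step_le_window k, h.error_le_window_succ k,
          h.step_le_window k]
    _ = (p.L + p.θ₁ * p.sigmaBound / 2 + p.κ) * window ω (p.N + 1) (k + 1) ^ 2 := by ring

theorem curvature_succ_le_window (h : ScalarRun p ω σ F g χ e) (k : ℕ) :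
    χ (k + 1) ≤ (p.κ + (p.L + p.θ₂ * p.sigmaBound)) * window ω (p.N + 1) (k + 1) := by
  have hL := p.L_nonneg
  have hθ₂ := p.θ₂_nonneg
  have hω := h.step_nonneg k
  have hS : 0 ≤ p.sigmaBound := (h.sigma_nonneg k).trans (h.sigma_le_sigmaBound k)
  rw [add_mul]
  refine (h.curvature_succ_le k).trans ?_
  gcongr
  exacts [h.error_le_window_succ k, h.sigma_le_sigmaBound k, h.step_le_window k]

theorem exists_gradient_le_and_curvature_le (h : ScalarRun p ω σ F g χ e) (k : ℕ) :
    ∃ j ≤ k, g (j + 1) ≤ p.gradientConst / ((k : ℝ) + 1) ^ (2 / 3 : ℝ) ∧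
      χ (j + 1) ≤ p.curvatureConst / ((k : ℝ) + 1) ^ (1 / 3 : ℝ) := by
  have hW := fun j => window_nonneg h.step_nonneg (p.N + 1) (j + 1)
  obtain ⟨j, hj, hle⟩ := exists_le_rpow_inv_of_sum_pow_le (t := Finset.range (k + 1)) (by simp)
    (fun j _ => hW j) three_ne_zero (h.sum_window_cube_le_windowCubeBound (k + 1))
  set W := window ω (p.N + 1) (j + 1)
  have hD : 0 ≤ p.windowCubeBound :=
    (Finset.sum_nonneg fun i _ => pow_nonneg (hW i) 3).trans
      (h.sum_window_cube_le_windowCubeBound 0)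
  have hk : (0 : ℝ) ≤ k + 1 := by positivity
  have hS : 0 ≤ p.sigmaBound := (h.sigma_nonneg 0).trans (h.sigma_le_sigmaBound 0)
  have hκ := p.κ_nonneg
  have hL := p.L_nonneg
  have hθ₁ := p.θ₁_nonneg
  have hθ₂ := p.θ₂_nonneg
  have hroot : W ≤ p.windowCubeBound ^ (1 / 3 : ℝ) / ((k : ℝ) + 1) ^ (1 / 3 : ℝ) := by
    rw [← Real.div_rpow hD hk]
    simpa using hle
  have hsq : W ^ 2 ≤ p.windowCubeBound ^ (2 / 3 : ℝ) / ((k : ℝ) + 1) ^ (2 / 3 : ℝ) := by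
    calc W ^ 2 ≤ (p.windowCubeBound ^ (1 / 3 : ℝ) / ((k : ℝ) + 1) ^ (1 / 3 : ℝ)) ^ 2 :=
          pow_le_pow_left₀ (hW j) hroot 2
      _ = p.windowCubeBound ^ (2 / 3 : ℝ) / ((k : ℝ) + 1) ^ (2 / 3 : ℝ) := by
          rw [div_pow, ← Real.rpow_mul_natCast hD, ← Real.rpow_mul_natCast hk]
          norm_num
  refine ⟨j, Nat.lt_succ_iff.1 (Finset.mem_range.1 hj), ?_, ?_⟩
  · exact (h.gradient_succ_le_window_sq j).trans
      ((mul_le_mul_of_nonneg_left hsq (by positivity)).trans_eq (mul_div_assoc _ _ _).symm)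
  · exact (h.curvature_succ_le_window j).trans
      ((mul_le_mul_of_nonneg_left hroot (by positivity)).trans_eq (mul_div_assoc _ _ _).symm)

end ScalarRun

section SelfAdjointPart

variable {A : Type*} [NormedAddCommGroup A] [NormedSpace ℝ A] [StarAddMonoid A]
  [NormedStarGroup A] [StarModule ℝ A]

theorem norm_selfAdjointPart_le (a : A) : ‖(selfAdjointPart ℝ a : A)‖ ≤ ‖a‖ := by
  rw [selfAdjointPart_apply_coe, invOf_eq_inv, norm_smul, norm_inv, Real.norm_two]
  linarith [norm_add_le a (star a), norm_star a]

theorem norm_selfAdjointPart_sub_le {h : A} (hh : IsSelfAdjoint h) (a : A) :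
    ‖(selfAdjointPart ℝ a : A) - h‖ ≤ ‖a - h‖ := by
  have hsub : (selfAdjointPart ℝ (a - h) : A) = selfAdjointPart ℝ a - h := by
    rw [map_sub, AddSubgroupClass.coe_sub, hh.coe_selfAdjointPart_apply ℝ]
  exact hsub ▸ norm_selfAdjointPart_le (a - h)

end SelfAdjointPart

section Hilbert

variable {E : Type*} [NormedAddCommGroup E] [InnerProductSpace ℝ E] {f : E → ℝ}

theorem abs_inner_apply_self_le (A : E →L[ℝ] E) (v : E) :
    |inner ℝ v (A v)| ≤ ‖A‖ * ‖v‖ ^ 2 :=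
  calc |inner ℝ v (A v)| ≤ ‖v‖ * ‖A v‖ := abs_real_inner_le_norm _ _
    _ ≤ ‖v‖ * (‖A‖ * ‖v‖) := by gcongr; exact A.le_opNorm v
    _ = ‖A‖ * ‖v‖ ^ 2 := by ring

variable [CompleteSpace E]

theorem hasGradientAt_quadratic (c : ℝ) (g : E) (B : E →L[ℝ] E) (s : E) :
    HasGradientAt (fun s => c + inner ℝ g s + 1 / 2 * inner ℝ s (B s))
      (g + (selfAdjointPart ℝ B : E →L[ℝ] E) s) s := by
  rw [hasGradientAt_iff_hasFDerivAt]
  have hlinear : HasFDerivAt (fun s => inner ℝ g s) (innerSL ℝ g) s := (innerSL ℝ g).hasFDerivAt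
  have hquadratic := ((hasFDerivAt_id s).inner ℝ B.hasFDerivAt).const_mul (1 / 2)
  refine ((hlinear.const_add c).add hquadratic).congr_fderiv ?_
  ext v
  simp only [one_div, id_eq, add_apply, coe_innerSL_apply, smul_apply,
    ContinuousLinearMap.comp_apply, ContinuousLinearMap.prod_apply, ContinuousLinearMap.id_apply,
    fderivInnerCLM_apply, real_inner_comm (B s) v, smul_eq_mul, selfAdjointPart_apply_coe,
    invOf_eq_inv, ContinuousLinearMap.star_eq_adjoint, smul_add, map_add, map_smul,
    InnerProductSpace.toDual_apply_apply, ContinuousLinearMap.adjoint_inner_left, add_right_inj]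
  ring

theorem contDiff_gradient (hf : ContDiff ℝ 2 f) : ContDiff ℝ 1 (gradient f) :=
  (InnerProductSpace.toDual ℝ E).symm.contDiff.comp (hf.fderiv_right (m := 1) (by norm_num))

theorem hasFDerivAt_gradient (hf : ContDiff ℝ 2 f) (y : E) :
    HasFDerivAt (gradient f) (fderiv ℝ (gradient f) y) y :=
  ((contDiff_gradient hf).differentiable (by norm_num) y).hasFDerivAt

theorem inner_fderiv_gradient_apply (hf : ContDiff ℝ 2 f) (y u v : E) :
    inner ℝ (fderiv ℝ (gradient f) y u) v = fderiv ℝ (fderiv ℝ f) y u v := by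
  have hcomp := ((InnerProductSpace.toDual ℝ E).hasFDerivAt.comp y
    (hasFDerivAt_gradient hf y)).fderiv
  rw [toDual_comp_gradient] at hcomp
  rw [hcomp]
  rfl

theorem isSelfAdjoint_fderiv_gradient (hf : ContDiff ℝ 2 f) (y : E) :
    IsSelfAdjoint (fderiv ℝ (gradient f) y) := by
  have hsymm : IsSymmSndFDerivAt ℝ f y := hf.contDiffAt.isSymmSndFDerivAt (by simp)
  refine ContinuousLinearMap.isSelfAdjoint_iff_isSymmetric.2 fun u v => ?_
  change inner ℝ (fderiv ℝ (gradient f) y u) v = inner ℝ u (fderiv ℝ (gradient f) y v)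
  rw [real_inner_comm _ u, inner_fderiv_gradient_apply hf, inner_fderiv_gradient_apply hf,
    hsymm.eq u v]

end Hilbert

section Taylor

variable {V W : Type*} [NormedAddCommGroup V] [NormedSpace ℝ V] [NormedAddCommGroup W]
  [NormedSpace ℝ W] {L : ℝ≥0}

theorem norm_sub_fderiv_apply_le {F : V → W} {F' : V → V →L[ℝ] W}
    (hF : ∀ y, HasFDerivAt F (F' y) y) (hLip : LipschitzWith L F') (x s : V) :
    ‖F (x + s) - F x - F' x s‖ ≤ L * ‖s‖ ^ 2 := by
  have hbound := (convex_closedBall x ‖s‖).norm_image_sub_le_of_norm_hasFDerivWithin_le'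
    (C := L * ‖s‖) (φ := F' x) (x := x) (y := x + s) (fun y _ => (hF y).hasFDerivWithinAt)
    (fun y hy => (hLip.norm_sub_le y x).trans (by gcongr; exact mem_closedBall_iff_norm.1 hy))
    (Metric.mem_closedBall_self (norm_nonneg s)) (by simp)
  rwa [add_sub_cancel_left, mul_assoc, ← sq] at hbound

variable {E : Type*} [NormedAddCommGroup E] [InnerProductSpace ℝ E] [CompleteSpace E] {f : E → ℝ}

theorem abs_sub_quadratic_le (hf : ContDiff ℝ 2 f) (hLip : LipschitzWith L (fderiv ℝ (gradient f)))
    (x s : E) :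
    |f (x + s) - (f x + inner ℝ (gradient f x) s +
      1 / 2 * inner ℝ s (fderiv ℝ (gradient f) x s))| ≤ L * ‖s‖ ^ 3 := by
  set φ : E → ℝ := fun s => f (x + s) - (f x + inner ℝ (gradient f x) s +
    1 / 2 * inner ℝ s (fderiv ℝ (gradient f) x s)) with hφ
  have hderiv : ∀ v, HasFDerivAt φ (InnerProductSpace.toDual ℝ E
      (gradient f (x + v) - gradient f x - fderiv ℝ (gradient f) x v)) v := fun v => by
    have htranslate : HasFDerivAt (fun v => f (x + v)) (fderiv ℝ f (x + v)) v :=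
      (hf.differentiable (by norm_num) (x + v)).hasFDerivAt.comp v ((hasFDerivAt_id v).const_add x)
    have hquadratic := (hasGradientAt_quadratic (f x) (gradient f x)
      (fderiv ℝ (gradient f) x) v).hasFDerivAt
    rw [(isSelfAdjoint_fderiv_gradient hf x).coe_selfAdjointPart_apply ℝ] at hquadratic
    refine (htranslate.sub hquadratic).congr_fderiv ?_
    rw [← toDual_gradient, ← map_sub, sub_sub]
  have hbound := (convex_closedBall (0 : E) ‖s‖).norm_image_sub_le_of_norm_hasFDerivWithin_le
    (C := L * ‖s‖ ^ 2) (fun v _ => (hderiv v).hasFDerivWithinAt)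
    (fun v hv => by
      rw [LinearIsometryEquiv.norm_map]
      refine (norm_sub_fderiv_apply_le (hasFDerivAt_gradient hf) hLip x v).trans ?_
      gcongr
      exact mem_closedBall_zero_iff.1 hv)
    (Metric.mem_closedBall_self (norm_nonneg s)) (y := s) (by simp)
  have hφ_zero : φ 0 = 0 := by simp [hφ]
  rwa [hφ_zero, sub_zero, sub_zero, Real.norm_eq_abs, mul_assoc, ← pow_succ] at hbound

variable [CompleteSpace W] {g : V → W}

theorem norm_integral_segment_sub_le (hg : LipschitzWith L g) {x s z : V}
    (hz : ∀ t ∈ Set.Icc (0 : ℝ) 1, ‖x + t • s - z‖ ≤ ‖s‖) :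
    ‖(∫ t in (0 : ℝ)..1, g (x + t • s)) - g z‖ ≤ L * ‖s‖ := by
  have hcont : Continuous fun t : ℝ => g (x + t • s) := hg.continuous.comp (by fun_prop)
  have hsub : (∫ t in (0 : ℝ)..1, g (x + t • s)) - g z =
      ∫ t in (0 : ℝ)..1, (g (x + t • s) - g z) := by
    rw [intervalIntegral.integral_sub (hcont.intervalIntegrable _ _) (by simp)]
    simp
  rw [hsub]
  refine (intervalIntegral.norm_integral_le_of_norm_le_const (C := L * ‖s‖) fun t ht => ?_).trans
    (by simp)
  rw [Set.uIoc_of_le zero_le_one] at ht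
  refine (hg.norm_sub_le _ _).trans ?_
  gcongr
  exact hz t ⟨ht.1.le, ht.2⟩

theorem norm_integral_segment_sub_left_le (hg : LipschitzWith L g) (x s : V) :
    ‖(∫ t in (0 : ℝ)..1, g (x + t • s)) - g x‖ ≤ L * ‖s‖ := by
  refine norm_integral_segment_sub_le hg fun t ht => ?_
  rw [add_sub_cancel_left, norm_smul, Real.norm_of_nonneg ht.1]
  exact mul_le_of_le_one_left (norm_nonneg _) ht.2

theorem norm_integral_segment_sub_right_le (hg : LipschitzWith L g) (x s : V) :
    ‖(∫ t in (0 : ℝ)..1, g (x + t • s)) - g (x + s)‖ ≤ L * ‖s‖ := by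
  refine norm_integral_segment_sub_le hg fun t ht => ?_
  have hpoint : x + t • s - (x + s) = -((1 - t) • s) := by module
  rw [hpoint, norm_neg, norm_smul, Real.norm_of_nonneg (sub_nonneg.2 ht.2)]
  exact mul_le_of_le_one_left (norm_nonneg _) (sub_le_self 1 ht.1)

end Taylor

section LambdaMin

variable {n : ℕ} {A : EuclideanSpace ℝ (Fin n) →L[ℝ] EuclideanSpace ℝ (Fin n)}

theorem lambdaMin_mul_norm_sq_le (hA : IsSelfAdjoint A) (v : EuclideanSpace ℝ (Fin n)) :
    lambdaMin A * ‖v‖ ^ 2 ≤ inner ℝ v (A v) := by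
  rcases eq_or_ne v 0 with rfl | hv
  · simp
  have : Nontrivial (EuclideanSpace ℝ (Fin n)) := ⟨⟨v, 0, hv⟩⟩
  have hsymm := ContinuousLinearMap.isSelfAdjoint_iff_isSymmetric.1 hA
  have hbdd : BddBelow (Set.range fun u : { u : EuclideanSpace ℝ (Fin n) // u ≠ 0 } =>
      A.rayleighQuotient u) := by
    refine ⟨-‖A‖, ?_⟩
    rintro _ ⟨u, rfl⟩
    exact neg_le_of_abs_le (A.rayleighQuotient_le_norm u)
  have hrayleigh : lambdaMin A ≤ A.rayleighQuotient v :=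
    (csInf_le (Module.End.finite_hasEigenvalue _).bddBelow
      hsymm.hasEigenvalue_iInf_of_finiteDimensional).trans (ciInf_le hbdd ⟨v, hv⟩)
  rw [real_inner_comm]
  exact (le_div_iff₀ (by positivity)).1 hrayleigh

theorem max_zero_neg_lambdaMin_le {c : ℝ} (hc : 0 ≤ c)
    (h : ∀ v, -c * ‖v‖ ^ 2 ≤ inner ℝ v (A v)) : max 0 (-lambdaMin A) ≤ c := by
  refine max_le hc (neg_le.1 ?_)
  unfold lambdaMin
  rcases Set.eq_empty_or_nonempty {μ : ℝ | Module.End.HasEigenvalue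
    (A : EuclideanSpace ℝ (Fin n) →ₗ[ℝ] EuclideanSpace ℝ (Fin n)) μ} with hempty | hne
  · rw [hempty, Real.sInf_empty]
    exact neg_nonpos.2 hc
  · refine le_csInf hne fun μ hμ => ?_
    obtain ⟨v, hv⟩ := Module.End.HasEigenvalue.exists_hasEigenvector hμ
    have hvA : A v = μ • v := hv.apply_eq_smul
    have hv_pos : 0 < ‖v‖ ^ 2 := pow_pos (norm_pos_iff.2 hv.2) 2
    have hmul := h v
    rw [hvA, real_inner_smul_right, real_inner_self_eq_norm_sq] at hmul
    exact le_of_mul_le_mul_right hmul hv_pos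

theorem max_zero_neg_lambdaMin_le_add_norm_sub (hA : IsSelfAdjoint A)
    (A' : EuclideanSpace ℝ (Fin n) →L[ℝ] EuclideanSpace ℝ (Fin n)) :
    max 0 (-lambdaMin A') ≤ max 0 (-lambdaMin A) + ‖A' - A‖ := by
  refine max_zero_neg_lambdaMin_le (add_nonneg (le_max_left _ _) (norm_nonneg _)) fun v => ?_
  have hneg : -max 0 (-lambdaMin A) * ‖v‖ ^ 2 ≤ lambdaMin A * ‖v‖ ^ 2 := by
    gcongr
    exact neg_le.1 (le_max_right _ _)
  have hperturb := neg_le_of_abs_le (abs_inner_apply_self_le (A' - A) v)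
  rw [sub_apply, inner_sub_right] at hperturb
  linarith [lambdaMin_mul_norm_sq_le hA v]

end LambdaMin

section Model

variable {n : ℕ}

theorem gradient_approxTaylor (f : EuclideanSpace ℝ (Fin n) → ℝ) (x : EuclideanSpace ℝ (Fin n))
    (B : EuclideanSpace ℝ (Fin n) →L[ℝ] EuclideanSpace ℝ (Fin n)) :
    gradient (approxTaylor f x B) = fun s => gradient f x +
      (selfAdjointPart ℝ B : EuclideanSpace ℝ (Fin n) →L[ℝ] EuclideanSpace ℝ (Fin n)) s :=
  gradient_eq (hasGradientAt_quadratic (f x) (gradient f x) B)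

theorem hessian_approxTaylor (f : EuclideanSpace ℝ (Fin n) → ℝ) (x s : EuclideanSpace ℝ (Fin n))
    (B : EuclideanSpace ℝ (Fin n) →L[ℝ] EuclideanSpace ℝ (Fin n)) :
    hessian (approxTaylor f x B) s = selfAdjointPart ℝ B := by
  rw [hessian, gradient_approxTaylor]
  exact ((selfAdjointPart ℝ B :
    EuclideanSpace ℝ (Fin n) →L[ℝ] EuclideanSpace ℝ (Fin n)).hasFDerivAt.const_add _).fderiv

end Model

/-- The data of the scalar recursion satisfied by every run with the given parameters on an
objective with `L`-Lipschitz Hessian. The approximation error is at most a constant times the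
sum of the last `2 * m` step lengths, since a refresh looks back over `m` steps and takes place at
most `m` iterations earlier. -/
def rateParams (m : ℕ) {θ₁ θ₂ κA σ₀ : ℝ} (κC Δ G β : ℝ) (L : ℝ≥0) (hθ₁ : 0 ≤ θ₁)
    (hθ₂ : 0 ≤ θ₂) (hκA : 0 ≤ κA) (hσ₀ : 0 < σ₀) : RateParams where
  N := 2 * m
  κ := max 1 κC ^ m * (κA + 2 * L)
  L := L
  θ₁ := θ₁
  θ₂ := θ₂
  σ₀ := σ₀
  Δ := Δ
  G := G
  β := β
  κ_nonneg := by positivity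
  L_nonneg := L.coe_nonneg
  θ₁_nonneg := hθ₁
  θ₂_nonneg := hθ₂
  σ₀_pos := hσ₀

namespace IsRun

variable {n m : ℕ} {θ₁ θ₂ κA κB κC σ₀ Δ G β : ℝ} {L : ℝ≥0} {f : EuclideanSpace ℝ (Fin n) → ℝ}
  {x s : ℕ → EuclideanSpace ℝ (Fin n)}
  {B : ℕ → EuclideanSpace ℝ (Fin n) →L[ℝ] EuclideanSpace ℝ (Fin n)} {σ : ℕ → ℝ}

theorem model_increment_le (h : IsRun m θ₁ θ₂ κA κB κC σ₀ f x s B σ) (k : ℕ) :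
    inner ℝ (gradient f (x k)) (s k) + 1 / 2 * inner ℝ (s k) (B k (s k)) ≤
      -(σ k / 6 * ‖s k‖ ^ 3) := by
  have hdecrease := h.model_decrease k
  simp only [model, approxTaylor, map_zero, inner_zero_right, norm_zero] at hdecrease
  linarith

theorem objective_succ_le (h : IsRun m θ₁ θ₂ κA κB κC σ₀ f x s B σ) (hf : ContDiff ℝ 2 f)
    (hLip : LipschitzWith L (hessian f)) (k : ℕ) :
    f (x (k + 1)) ≤ f (x k) - σ k / 6 * ‖s k‖ ^ 3 + L * ‖s k‖ ^ 3 +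
      ‖B k - hessian f (x k)‖ * ‖s k‖ ^ 2 := by
  have htaylor : f (x k + s k) - (f (x k) + inner ℝ (gradient f (x k)) (s k) +
      1 / 2 * inner ℝ (s k) (hessian f (x k) (s k))) ≤ L * ‖s k‖ ^ 3 :=
    (le_abs_self _).trans (abs_sub_quadratic_le hf hLip (x k) (s k))
  have herror := neg_le_of_abs_le (abs_inner_apply_self_le (B k - hessian f (x k)) (s k))
  have herror_nonneg : 0 ≤ ‖B k - hessian f (x k)‖ * ‖s k‖ ^ 2 := by positivity
  rw [sub_apply, inner_sub_right] at herror
  rw [h.iterate_succ]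
  linarith [h.model_increment_le k]

theorem cubic_le (h : IsRun m θ₁ θ₂ κA κB κC σ₀ f x s B σ) (hf : ContDiff ℝ 2 f) (k : ℕ) :
    σ k / 6 * ‖s k‖ ^ 3 ≤ ‖gradient f (x k)‖ * ‖s k‖ +
      (negCurvature f (x k) + ‖B k - hessian f (x k)‖) * ‖s k‖ ^ 2 := by
  have hgradient := neg_le_of_abs_le (abs_real_inner_le_norm (gradient f (x k)) (s k))
  have herror := neg_le_of_abs_le (abs_inner_apply_self_le (B k - hessian f (x k)) (s k))
  have hcurvature := lambdaMin_mul_norm_sq_le (isSelfAdjoint_fderiv_gradient hf (x k)) (s k)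
  have hneg : -negCurvature f (x k) * ‖s k‖ ^ 2 ≤ lambdaMin (hessian f (x k)) * ‖s k‖ ^ 2 := by
    gcongr
    exact neg_le.1 (le_max_right _ _)
  have herror_nonneg : 0 ≤ ‖B k - hessian f (x k)‖ * ‖s k‖ ^ 2 := by positivity
  have hneg_nonneg : 0 ≤ negCurvature f (x k) * ‖s k‖ ^ 2 :=
    mul_nonneg (le_max_left _ _) (sq_nonneg _)
  rw [sub_apply, inner_sub_right] at herror
  change lambdaMin (hessian f (x k)) * ‖s k‖ ^ 2 ≤
    inner ℝ (s k) (hessian f (x k) (s k)) at hcurvature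
  linarith [h.model_increment_le k]

theorem norm_gradient_succ_le (h : IsRun m θ₁ θ₂ κA κB κC σ₀ f x s B σ) (hf : ContDiff ℝ 2 f)
    (hLip : LipschitzWith L (hessian f)) (k : ℕ) :
    ‖gradient f (x (k + 1))‖ ≤ (L + θ₁ * σ k / 2) * ‖s k‖ ^ 2 +
      ‖B k - hessian f (x k)‖ * ‖s k‖ := by
  set S := (selfAdjointPart ℝ (B k)).1
  have hremainder : ‖gradient f (x k + s k) - gradient f (x k) - hessian f (x k) (s k)‖ ≤
      L * ‖s k‖ ^ 2 := norm_sub_fderiv_apply_le (hasFDerivAt_gradient hf) hLip (x k) (s k)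
  have hmodel : ‖gradient f (x k) + S (s k)‖ ≤ θ₁ * σ k * ‖s k‖ ^ 2 / 2 := by
    simpa only [gradient_approxTaylor] using h.step_gradient k
  have herror : ‖(S - hessian f (x k)) (s k)‖ ≤ ‖B k - hessian f (x k)‖ * ‖s k‖ :=
    ContinuousLinearMap.le_of_opNorm_le _
      (norm_selfAdjointPart_sub_le (isSelfAdjoint_fderiv_gradient hf (x k)) (B k)) _
  have hsplit : gradient f (x (k + 1)) =
      (gradient f (x k + s k) - gradient f (x k) - hessian f (x k) (s k)) +
        (gradient f (x k) + S (s k)) - (S - hessian f (x k)) (s k) := by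
    rw [h.iterate_succ, sub_apply]
    abel
  rw [hsplit]
  refine (norm_sub_le _ _).trans ((add_le_add (norm_add_le _ _) le_rfl).trans ?_)
  linarith

theorem negCurvature_succ_le (h : IsRun m θ₁ θ₂ κA κB κC σ₀ f x s B σ) (hf : ContDiff ℝ 2 f)
    (hLip : LipschitzWith L (hessian f)) (k : ℕ) :
    negCurvature f (x (k + 1)) ≤
      ‖B k - hessian f (x k)‖ + (L + θ₂ * σ k) * ‖s k‖ := by
  set S := (selfAdjointPart ℝ (B k)).1
  have hmodel : max 0 (-lambdaMin S) ≤ θ₂ * σ k * ‖s k‖ := by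
    simpa only [negCurvature, hessian_approxTaylor] using h.step_curvature k
  have hlipschitz : ‖hessian f (x (k + 1)) - hessian f (x k)‖ ≤ L * ‖s k‖ := by
    simpa [h.iterate_succ] using hLip.norm_sub_le (x (k + 1)) (x k)
  have herror : ‖S - hessian f (x k)‖ ≤ ‖B k - hessian f (x k)‖ :=
    norm_selfAdjointPart_sub_le (isSelfAdjoint_fderiv_gradient hf (x k)) (B k)
  calc negCurvature f (x (k + 1))
      ≤ max 0 (-lambdaMin S) + ‖hessian f (x (k + 1)) - S‖ :=
        max_zero_neg_lambdaMin_le_add_norm_sub (selfAdjointPart ℝ (B k)).2 _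
    _ ≤ θ₂ * σ k * ‖s k‖ + (L * ‖s k‖ + ‖B k - hessian f (x k)‖) := by
        refine add_le_add hmodel ((norm_sub_le_norm_sub_add_norm_sub _ (hessian f (x k)) _).trans
          (add_le_add hlipschitz ?_))
        rwa [norm_sub_rev]
    _ = ‖B k - hessian f (x k)‖ + (L + θ₂ * σ k) * ‖s k‖ := by ring

theorem hessianError_succ_le (h : IsRun m θ₁ θ₂ κA κB κC σ₀ f x s B σ)
    (hLip : LipschitzWith L (hessian f)) {k : ℕ} (hk : (k + 1) % m ≠ 0) :
    ‖B (k + 1) - hessian f (x (k + 1))‖ ≤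
      max 1 κC * (‖B k - hessian f (x k)‖ + 2 * L * ‖s k‖) := by
  set H := averagedHessian f (x k) (s k)
  have hleft : ‖H - hessian f (x k)‖ ≤ L * ‖s k‖ :=
    norm_integral_segment_sub_left_le hLip (x k) (s k)
  have hright : ‖H - hessian f (x (k + 1))‖ ≤ L * ‖s k‖ :=
    h.iterate_succ k ▸ norm_integral_segment_sub_right_le hLip (x k) (s k)
  have hLs : 0 ≤ L * ‖s k‖ := by positivity
  calc ‖B (k + 1) - hessian f (x (k + 1))‖
      ≤ ‖B (k + 1) - H‖ + ‖H - hessian f (x (k + 1))‖ := norm_sub_le_norm_sub_add_norm_sub _ _ _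
    _ ≤ max 1 κC * ‖B k - H‖ + max 1 κC * (L * ‖s k‖) := by
        refine add_le_add ((h.update k hk).trans ?_)
          (hright.trans (le_mul_of_one_le_left hLs (le_max_left 1 κC)))
        gcongr
        exact le_max_right 1 κC
    _ ≤ max 1 κC * (‖B k - hessian f (x k)‖ + L * ‖s k‖) + max 1 κC * (L * ‖s k‖) := by
        gcongr
        refine (norm_sub_le_norm_sub_add_norm_sub _ (hessian f (x k)) _).trans ?_
        gcongr
        rwa [norm_sub_rev]
    _ = max 1 κC * (‖B k - hessian f (x k)‖ + 2 * L * ‖s k‖) := by ring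

theorem hessianError_le_window (h : IsRun m θ₁ θ₂ κA κB κC σ₀ f x s B σ)
    (hLip : LipschitzWith L (hessian f)) (hm : 1 ≤ m) (hκA : 0 ≤ κA) (k : ℕ) :
    ‖B k - hessian f (x k)‖ ≤
      max 1 κC ^ m * (κA + 2 * L) * window (fun j => ‖s j‖) (2 * m) k := by
  refine error_le_window (e := fun k => ‖B k - hessian f (x k)‖) hm hκA (by positivity)
    (le_max_left 1 κC) (fun _ => norm_nonneg _) (fun k hk => ?_)
    (fun _ hk => h.hessianError_succ_le hLip hk) k
  rw [← sum_stepLength_eq_window]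
  exact (h.refresh k hk).trans (min_le_left _ _)

theorem scalarRun (h : IsRun m θ₁ θ₂ κA κB κC σ₀ f x s B σ) (hf : ContDiff ℝ 2 f)
    (hLip : LipschitzWith L (hessian f)) (hm : 1 ≤ m) (hθ₁ : 0 ≤ θ₁) (hθ₂ : 0 ≤ θ₂)
    (hκA : 0 ≤ κA) (hσ₀ : 0 < σ₀) (hΔ : ∀ k, f (x 0) - f (x k) ≤ Δ)
    (hG : ‖gradient f (x 0)‖ ≤ G) (hβ : negCurvature f (x 0) ≤ β) :
    ScalarRun (rateParams m κC Δ G β L hθ₁ hθ₂ hκA hσ₀) (fun k => ‖s k‖) σ (fun k => f (x k))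
      (fun k => ‖gradient f (x k)‖) (fun k => negCurvature f (x k))
      (fun k => ‖B k - hessian f (x k)‖) where
  step_nonneg _ := norm_nonneg _
  sigma_zero := h.sigma_zero
  sigma_succ := h.sigma_succ
  decrease_le := hΔ
  gradient_zero_le := hG
  curvature_zero_le := hβ
  objective_succ_le := h.objective_succ_le hf hLip
  cubic_le := h.cubic_le hf
  gradient_succ_le := h.norm_gradient_succ_le hf hLip
  curvature_succ_le := h.negCurvature_succ_le hf hLip
  error_le := h.hessianError_le_window hLip hm hκA

end IsRun

end ARApprox

theorem mainTheorem6_general (m : ℕ) (θ₁ θ₂ κA κB κC σ₀ Δ G β : ℝ) (L : ℝ≥0) (hm : 1 ≤ m)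
    (hθ₁ : 0 ≤ θ₁) (hθ₂ : 0 ≤ θ₂) (hκA : 0 ≤ κA) (hσ₀ : 0 < σ₀) :
    ∃ C₁ C₂ : ℝ, ∀ (n : ℕ) (f : EuclideanSpace ℝ (Fin n) → ℝ)
      (x s : ℕ → EuclideanSpace ℝ (Fin n))
      (B : ℕ → EuclideanSpace ℝ (Fin n) →L[ℝ] EuclideanSpace ℝ (Fin n)) (σ : ℕ → ℝ),
      ContDiff ℝ 2 f →
      LipschitzWith L (ARApprox.hessian f) →
      ARApprox.IsRun m θ₁ θ₂ κA κB κC σ₀ f x s B σ →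
      (∀ k, f (x 0) - f (x k) ≤ Δ) →
      ‖gradient f (x 0)‖ ≤ G →
      ARApprox.negCurvature f (x 0) ≤ β →
      ∀ k : ℕ, ∃ j ∈ Finset.Icc 1 (k + 1),
        ‖gradient f (x j)‖ ≤ C₁ / ((k : ℝ) + 1) ^ (2 / 3 : ℝ) ∧
        ARApprox.negCurvature f (x j) ≤ C₂ / ((k : ℝ) + 1) ^ (1 / 3 : ℝ) := by
  let p := ARApprox.rateParams m κC Δ G β L hθ₁ hθ₂ hκA hσ₀
  refine ⟨p.gradientConst, p.curvatureConst,
    fun n f x s B σ hf hLip hrun hΔ hG hβ k => ?_⟩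
  obtain ⟨j, hjk, hrates⟩ := (hrun.scalarRun hf hLip hm hθ₁ hθ₂ hκA hσ₀ hΔ hG
    hβ).exists_gradient_le_and_curvature_le k
  exact ⟨j + 1, Finset.mem_Icc.2 ⟨Nat.le_add_left 1 j, Nat.succ_le_succ hjk⟩, hrates⟩

theorem mainTheorem6 (m : ℕ) (θ₁ θ₂ κA κB κC σ₀ L Δ G β : ℝ)
    (hm : 1 ≤ m) (hθ₁ : 1 < θ₁) (hθ₂ : 1 < θ₂) (hκA : 0 < κA) (hκB : 0 < κB) (hκC : 1 ≤ κC)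
    (hσ₀ : 0 < σ₀) (hL : 3 ≤ L) :
    ∃ C₁ C₂ : ℝ, ∀ (n : ℕ) (f : EuclideanSpace ℝ (Fin n) → ℝ) (f_low : ℝ)
      (x s : ℕ → EuclideanSpace ℝ (Fin n))
      (B : ℕ → EuclideanSpace ℝ (Fin n) →L[ℝ] EuclideanSpace ℝ (Fin n)) (σ : ℕ → ℝ),
      ContDiff ℝ 2 f →
      (∀ y, f_low ≤ f y) →
      (∀ y z, ‖ARApprox.hessian f y - ARApprox.hessian f z‖ ≤ L * ‖y - z‖) →
      ARApprox.IsRun m θ₁ θ₂ κA κB κC σ₀ f x s B σ →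
      f (x 0) - f_low ≤ Δ →
      ‖gradient f (x 0)‖ ≤ G →
      ARApprox.negCurvature f (x 0) ≤ β →
      ∀ k : ℕ,
        (Finset.Icc 1 (k + 1)).inf' (Finset.nonempty_Icc.2 (Nat.le_add_left 1 k))
            (fun j => ‖gradient f (x j)‖) ≤ C₁ / ((k : ℝ) + 1) ^ (2 / 3 : ℝ) ∧
        (Finset.Icc 1 (k + 1)).inf' (Finset.nonempty_Icc.2 (Nat.le_add_left 1 k))
            (fun j => ARApprox.negCurvature f (x j)) ≤ C₂ / ((k : ℝ) + 1) ^ (1 / 3 : ℝ) := by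
  lift L to ℝ≥0 using by linarith
  obtain ⟨C₁, C₂, hrate⟩ := mainTheorem6_general m θ₁ θ₂ κA κB κC σ₀ Δ G β L hm
    (by linarith) (by linarith) hκA.le hσ₀
  refine ⟨C₁, C₂, fun n f f_low x s B σ hf hlow hLip hrun hΔ hG hβ k => ?_⟩
  obtain ⟨j, hj, hgradient, hcurvature⟩ := hrate n f x s B σ hf
    (LipschitzWith.of_dist_le_mul fun y z => by simpa only [dist_eq_norm] using hLip y z) hrun
    (fun i => by linarith [hlow (x i)]) hG hβ k
  exact ⟨(Finset.inf'_le _ hj).trans hgradient, (Finset.inf'_le _ hj).trans hcurvature⟩
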